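/- **Lemma 2.3.** Let $N,m$ be integers with $N\ge 4$, $2\le m\le N/2$ and $N-2m\neq 1$, let $p\in\left(2,\,4+\frac4N\right)$ and $\lambda>0$. Let $f:\mathbb R\to\mathbb R$ be the unique odd function with $f'(t)=\frac{1}{\sqrt{1+2f(t)^2}}$ for all $t\in\mathbb R$. Write $x=(x_1,x_2,x_3)\in\mathbb R^N=\mathbb R^m\times\mathbb R^m\times\mathbb R^{N-2m}$, let $\tau(x_1,x_2,x_3)=(x_2,x_1,x_3)$, and let $\mathbf G=O(m)\times O(m)\times O(N-2m)\subset O(N)$. Let $\mathbf Y_{\mathbf G}$ be the set of all real-valued $v\in H^1(\mathbb R^N)$ such that $v\circ g=v$ for all $g\in\mathbf G$ and $v\circ\tau=-v$ (almost everywhere), and put $$\mathbb Y_\lambda=\Big\{v\in\mathbf Y_{\mathbf G}:\ \int_{\mathbb R^N}|f(v)|^2\,dx=\lambda\Big\},\qquad I(v)=\frac12\int_{\mathbb R^N}|\nabla v|^2\,dx-\frac1p\int_{\mathbb R^N}|f(v)|^p\,dx,\qquad I_\lambda=\inf_{v\in\mathbb Y_\lambda}I(v).$$ Then: 1. $\int_{\mathbb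 R^N}|f(v)|^p\,dx<\infty$ for every $v\in\mathbb Y_\lambda$ (so that $I(v)$ is a well-defined real number), and $I_\lambda$ is finite, that is, $-\infty<I_\lambda<+\infty$, where $\inf\emptyset=+\infty$ (so $\mathbb Y_\lambda\ne\emptyset$). 2. Every minimizing sequence, that is, every sequence $(v_n)$ in $\mathbb Y_\lambda$ with $I(v_n)\to I_\lambda$, is bounded in $H^1(\mathbb R^N)$. -/

import Mathlib

open MeasureTheory Filter Topology
open scoped ContDiff

noncomputable section

namespace DualNLS

/-! ## The dual function -/

/-- `f` is odd and solves `f' = 1 / √(1 + 2 f²)` on the real line. -/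
def IsDualFunction (f : ℝ → ℝ) : Prop :=
  (∀ t, f (-t) = -f t) ∧ ∀ t, HasDerivAt f (1 / √(1 + 2 * f t ^ 2)) t

/-- Auxiliary primitive of `√(1 + 2 r²)`; its inverse is the dual function. -/
def primitive (s : ℝ) : ℝ := ∫ r in (0 : ℝ)..s, √(1 + 2 * r ^ 2)

theorem hasDerivAt_primitive (s : ℝ) : HasDerivAt primitive (√(1 + 2 * s ^ 2)) s := by
  have hc : Continuous fun r : ℝ => √(1 + 2 * r ^ 2) := by fun_prop
  exact intervalIntegral.integral_hasDerivAt_right (hc.intervalIntegrable _ _)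
    hc.aestronglyMeasurable.stronglyMeasurableAtFilter hc.continuousAt

theorem strictMono_primitive : StrictMono primitive :=
  strictMono_of_deriv_pos fun s => by
    rw [(hasDerivAt_primitive s).deriv]
    positivity

theorem primitive_neg (s : ℝ) : primitive (-s) = -primitive s := by
  have h := intervalIntegral.integral_comp_neg (a := 0) (b := s)
    (fun r : ℝ => √(1 + 2 * r ^ 2))
  simp only [neg_sq, neg_zero] at h
  unfold primitive
  rw [h, intervalIntegral.integral_symm]

theorem le_primitive {s : ℝ} (hs : 0 ≤ s) : s ≤ primitive s := by
  have hm : Monotone fun x => primitive x - x := by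
    apply monotone_of_deriv_nonneg
    · intro x
      exact ((hasDerivAt_primitive x).sub (hasDerivAt_id x)).differentiableAt
    · intro x
      have h := ((hasDerivAt_primitive x).sub (hasDerivAt_id x)).deriv
      have h1 : (1 : ℝ) ≤ √(1 + 2 * x ^ 2) := by
        rw [Real.one_le_sqrt]; nlinarith [sq_nonneg x]
      have h2 : deriv (fun x => primitive x - x) x = √(1 + 2 * x ^ 2) - 1 := h
      rw [h2]; linarith
  have h := hm hs
  simp only [primitive, intervalIntegral.integral_same] at h
  simp only [primitive]
  linarith

theorem surjective_primitive : Function.Surjective primitive := by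
  have htop : Tendsto primitive atTop atTop :=
    tendsto_atTop_mono' atTop
      (by filter_upwards [eventually_ge_atTop (0 : ℝ)] with s hs using le_primitive hs) tendsto_id
  have hbot : Tendsto primitive atBot atBot := by
    have h := tendsto_neg_atTop_atBot.comp (htop.comp tendsto_neg_atBot_atTop)
    refine h.congr fun s => ?_
    simp [primitive_neg]
  have hcont : Continuous primitive :=
    continuous_iff_continuousAt.2 fun s => (hasDerivAt_primitive s).continuousAt
  exact hcont.surjective htop hbot

theorem existsUnique_dualFunction : ∃! f : ℝ → ℝ, IsDualFunction f := by
  let e : ℝ ≃o ℝ := strictMono_primitive.orderIsoOfSurjective primitive surjective_primitive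
  have he : ∀ t, primitive (e.symm t) = t := fun t => e.apply_symm_apply t
  refine ⟨e.symm, ⟨fun t => ?_, fun t => ?_⟩, fun g hg => ?_⟩
  · apply strictMono_primitive.injective
    rw [primitive_neg, he, he]
  · rw [one_div]
    exact HasDerivAt.of_local_left_inverse e.symm.continuous.continuousAt
      (hasDerivAt_primitive _) (by positivity) (Eventually.of_forall he)
  · have h0 : g 0 = 0 := by
      have h := hg.1 0
      rw [neg_zero] at h
      linarith
    have hd : ∀ t, HasDerivAt (fun s => primitive (g s) - s) 0 t := fun t => by
      have h := ((hasDerivAt_primitive (g t)).comp t (hg.2 t)).sub (hasDerivAt_id t)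
      have hne : √(1 + 2 * g t ^ 2) ≠ 0 := by positivity
      have hz : √(1 + 2 * g t ^ 2) * (1 / √(1 + 2 * g t ^ 2)) - 1 = 0 := by
        field_simp
        ring
      rw [hz] at h
      exact h
    funext t
    apply strictMono_primitive.injective
    have hc := is_const_of_deriv_eq_zero (fun s => (hd s).differentiableAt)
      (fun s => (hd s).deriv) t 0
    simp only [h0] at hc
    have hp0 : primitive 0 = 0 := by simp [primitive]
    rw [hp0] at hc
    rw [he]
    linarith

/-- The dual function: the unique odd solution of `f' = 1 / √(1 + 2 f²)`. -/
def dual : ℝ → ℝ := existsUnique_dualFunction.choose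

theorem isDualFunction_dual : IsDualFunction dual := existsUnique_dualFunction.choose_spec.1

/-! ## The space `H¹(ℝᴺ)` of real functions

Elements are represented by functions; everything below depends only on the class modulo
equality almost everywhere. -/

/-- `g` is a weak gradient of `v`: `∫ v ∂ᵢφ = -∫ gᵢ φ` for every test function `φ` and every `i`. -/
def IsWeakGradient {N : ℕ} (v : EuclideanSpace ℝ (Fin N) → ℝ)
    (g : EuclideanSpace ℝ (Fin N) → EuclideanSpace ℝ (Fin N)) : Prop :=
  ∀ φ : EuclideanSpace ℝ (Fin N) → ℝ, ContDiff ℝ ∞ φ → HasCompactSupport φ → ∀ i : Fin N,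
    ∫ x, v x * fderiv ℝ φ x (EuclideanSpace.single i 1) = -∫ x, g x i * φ x

/-- `v ∈ H¹(ℝᴺ)`: `v ∈ L²` has a weak gradient in `L²`. -/
def MemH1 {N : ℕ} (v : EuclideanSpace ℝ (Fin N) → ℝ) : Prop :=
  MemLp v 2 volume ∧
    ∃ g : EuclideanSpace ℝ (Fin N) → EuclideanSpace ℝ (Fin N),
      MemLp g 2 volume ∧ IsWeakGradient v g

open Classical in
/-- The weak gradient `∇v` of `v ∈ H¹(ℝᴺ)` (unique up to a null set); zero if `v ∉ H¹(ℝᴺ)`. -/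
def weakGradient {N : ℕ} (v : EuclideanSpace ℝ (Fin N) → ℝ) :
    EuclideanSpace ℝ (Fin N) → EuclideanSpace ℝ (Fin N) :=
  if h : MemH1 v then h.2.choose else 0

theorem MemH1.weakGradient_spec {N : ℕ} {v : EuclideanSpace ℝ (Fin N) → ℝ} (h : MemH1 v) :
    MemLp (weakGradient v) 2 volume ∧ IsWeakGradient v (weakGradient v) := by
  rw [weakGradient, dif_pos h]
  exact h.2.choose_spec

/-- The norm of `H¹(ℝᴺ)`, `(‖v‖₂² + ‖∇v‖₂²)^(1/2)`. -/
def h1Norm {N : ℕ} (v : EuclideanSpace ℝ (Fin N) → ℝ) : ℝ :=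
  √((∫ x, v x ^ 2) + ∫ x, ‖weakGradient v x‖ ^ 2)

/-! ## The symmetries of `ℝᴺ = ℝᵐ × ℝᵐ × ℝᴺ⁻²ᵐ` -/

/-- Exchange of the index blocks `{0, …, m-1}` and `{m, …, 2m-1}`, the others being fixed. -/
def swapIndex (N m : ℕ) (i : Fin N) : Fin N :=
  if h : i.val < m ∧ i.val + m < N then ⟨i.val + m, h.2⟩
  else if m ≤ i.val ∧ i.val < 2 * m then ⟨i.val - m, by have := i.isLt; omega⟩
  else i

theorem swapIndex_involutive (N m : ℕ) : Function.Involutive (swapIndex N m) := by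
  intro i
  have hi := i.isLt
  by_cases h1 : i.val < m ∧ i.val + m < N
  · have e : swapIndex N m i = ⟨i.val + m, h1.2⟩ := dif_pos h1
    rw [e]
    ext
    simp only [swapIndex]
    split_ifs <;> (simp only []; omega)
  · by_cases h2 : m ≤ i.val ∧ i.val < 2 * m
    · have e : swapIndex N m i = ⟨i.val - m, by omega⟩ := by
        unfold swapIndex; rw [dif_neg h1, if_pos h2]
      rw [e]
      ext
      simp only [swapIndex]
      split_ifs <;> (simp only []; omega)
    · have e : swapIndex N m i = i := by
        unfold swapIndex; rw [dif_neg h1, if_neg h2]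
      rw [e, e]

/-- The isometry `τ (x₁, x₂, x₃) = (x₂, x₁, x₃)`, for `x₁, x₂ ∈ ℝᵐ` and `x₃ ∈ ℝᴺ⁻²ᵐ`
(where `2 * m ≤ N`). -/
def tau (N m : ℕ) : EuclideanSpace ℝ (Fin N) ≃ₗᵢ[ℝ] EuclideanSpace ℝ (Fin N) :=
  LinearIsometryEquiv.piLpCongrLeft 2 ℝ ℝ (swapIndex_involutive N m).toPerm

/-- The number (0, 1 or 2) of the block of `ℝᵐ × ℝᵐ × ℝᴺ⁻²ᵐ` to which a coordinate belongs. -/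
def blockIndex {N : ℕ} (m : ℕ) (i : Fin N) : Fin 3 :=
  if i.val < m then 0 else if i.val < 2 * m then 1 else 2

/-- The group `G = O(m) × O(m) × O(N - 2m)`, embedded in `O(N)` as the group of block diagonal
orthogonal matrices (the diagonal blocks of such a matrix are orthogonal). -/
def blockGroup (N m : ℕ) : Subgroup (Matrix.orthogonalGroup (Fin N) ℝ) where
  carrier := {A | ∀ i j : Fin N, blockIndex m i ≠ blockIndex m j → A.1 i j = 0}
  mul_mem' := by
    intro A B hA hB i j hij
    change (A.1 * B.1) i j = 0
    rw [Matrix.mul_apply]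
    refine Finset.sum_eq_zero fun k _ => ?_
    by_cases hik : blockIndex m i = blockIndex m k
    · rw [hB k j (fun h => hij (hik.trans h)), mul_zero]
    · rw [hA i k hik, zero_mul]
  one_mem' := by
    intro i j hij
    change (1 : Matrix (Fin N) (Fin N) ℝ) i j = 0
    exact Matrix.one_apply_ne fun h => hij (by rw [h])
  inv_mem' := by
    intro A hA i j hij
    change (star A.1) i j = 0
    rw [Matrix.star_apply, hA j i (Ne.symm hij), star_zero]

/-! ## The constraint set and the functional -/

/-- The space `Y_G` of all `v ∈ H¹(ℝᴺ)` that are invariant under `G` and satisfy `v ∘ τ = -v`. -/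
def YG (N m : ℕ) : Set (EuclideanSpace ℝ (Fin N) → ℝ) :=
  {v | MemH1 v ∧
    (∀ A ∈ blockGroup N m, ∀ᵐ x, v (Matrix.toEuclideanLin A.1 x) = v x) ∧
    ∀ᵐ x, v (tau N m x) = -v x}

/-- The constraint `𝕐_λ = {v ∈ Y_G : ‖f(v)‖₂² = λ}`. -/
def constraintSet (N m : ℕ) (lam : ℝ) : Set (EuclideanSpace ℝ (Fin N) → ℝ) :=
  {v | v ∈ YG N m ∧ ∫ x, |dual (v x)| ^ 2 = lam}

/-- The functional `I(v) = ½ ∫ |∇v|² - (1/p) ∫ |f(v)|ᵖ`. -/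
def energy {N : ℕ} (p : ℝ) (v : EuclideanSpace ℝ (Fin N) → ℝ) : ℝ :=
  1 / 2 * (∫ x, ‖weakGradient v x‖ ^ 2) - 1 / p * ∫ x, |dual (v x)| ^ p

/-- The infimum `I_λ` of `I` over `𝕐_λ`, as an extended real number. -/
def infEnergy (N m : ℕ) (p lam : ℝ) : EReal :=
  ⨅ v ∈ constraintSet N m lam, (energy p v : EReal)

end DualNLS

end

open scoped Convolution

namespace DualNLS

/-! ## Elementary properties of the dual function -/

/-! Write `f` for `dual` and put `w = f(v)²`. Since `2 f f' = 2f / √(1 + 2f²)` is at most `√2` in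
absolute value, `|∇w| ≤ √2 |∇v|`: the Sobolev inequality applies to `w`, although the constraint
only controls `∫ w`. Interpolating `∫ |f(v)|^p = ∫ w^(p/2)` between `L¹` and `L^(2N/(N-2))` bounds
it by a power of the constraint value times `(∫ |∇v|²)^θ`, and `θ < 1` holds exactly when `p < 4 +
4/N` (`exists_gagliardoNirenberg`).

By Young's inequality a quarter of the Dirichlet integral then survives in the energy
(`exists_gradient_le_energy`), so the infimum is not `-∞` and gradients of minimizing sequences are
bounded. The `L²` norm follows from `t² ≤ f(t)² + 2 f(t)⁴` and the same estimate with the exponent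
4, which is always admissible (`exists_integral_sq_le`). The infimum is not `+∞` because a dilated
bump with the required symmetries meets the constraint (`constraintSet_nonempty`).

The Sobolev inequality is used for `C¹` functions with compact support. The passage to `H¹`
truncates mollifications (`exists_approx`); convexity of `f²` and Jensen's inequality keep the
constraint integral from increasing, and Fatou's lemma gives the limit. -/

theorem hasDerivAt_dual (t : ℝ) : HasDerivAt dual (1 / √(1 + 2 * dual t ^ 2)) t :=
  isDualFunction_dual.2 t

theorem dual_neg (t : ℝ) : dual (-t) = -dual t := isDualFunction_dual.1 t

theorem dual_zero : dual 0 = 0 := by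
  have h := dual_neg 0
  rw [neg_zero] at h
  linarith

theorem continuous_dual : Continuous dual :=
  continuous_iff_continuousAt.2 fun t => (hasDerivAt_dual t).continuousAt

theorem contDiff_dual : ContDiff ℝ 1 dual := by
  rw [contDiff_one_iff_deriv]
  refine ⟨fun t => (hasDerivAt_dual t).differentiableAt, ?_⟩
  have h : deriv dual = fun t => 1 / √(1 + 2 * dual t ^ 2) :=
    funext fun t => (hasDerivAt_dual t).deriv
  rw [h]
  have hc := continuous_dual
  exact continuous_const.div (by fun_prop) fun t => by positivity

theorem monotone_dual : Monotone dual :=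
  monotone_of_deriv_nonneg (fun t => (hasDerivAt_dual t).differentiableAt) fun t => by
    rw [(hasDerivAt_dual t).deriv]
    positivity

theorem dual_nonneg {t : ℝ} (ht : 0 ≤ t) : 0 ≤ dual t := dual_zero ▸ monotone_dual ht

theorem dual_ne_zero {t : ℝ} (ht : t ≠ 0) : dual t ≠ 0 := by
  have hs : StrictMono dual := strictMono_of_deriv_pos fun t => by
    rw [(hasDerivAt_dual t).deriv]
    positivity
  intro h
  exact ht (hs.injective (h.trans dual_zero.symm))

theorem abs_dual (t : ℝ) : |dual t| = dual |t| := by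
  rcases le_total 0 t with ht | ht
  · rw [abs_of_nonneg ht, abs_of_nonneg (dual_nonneg ht)]
  · rw [abs_of_nonpos ht, dual_neg, abs_of_nonpos]
    exact dual_zero ▸ monotone_dual ht

theorem abs_dual_le (t : ℝ) : |dual t| ≤ |t| := by
  rw [abs_dual]
  have hm : Monotone fun x => x - dual x := by
    apply monotone_of_deriv_nonneg
    · exact fun x => ((hasDerivAt_id x).sub (hasDerivAt_dual x)).differentiableAt
    · intro x
      have h : deriv (fun x => x - dual x) x = 1 - 1 / √(1 + 2 * dual x ^ 2) :=
        ((hasDerivAt_id x).sub (hasDerivAt_dual x)).deriv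
      have h1 : (1 : ℝ) ≤ √(1 + 2 * dual x ^ 2) := by
        rw [Real.one_le_sqrt]; nlinarith [sq_nonneg (dual x)]
      rw [h]
      have := (div_le_one (by positivity)).2 h1
      linarith
  have h := hm (abs_nonneg t)
  simp only [dual_zero] at h
  linarith

theorem dual_sq_le (t : ℝ) : dual t ^ 2 ≤ t ^ 2 := sq_le_sq.2 (abs_dual_le t)

/-- The derivative of `f √(1 + 2f²)` is `1 + 2f² / (1 + 2f²) ≥ 1`, and the function vanishes at 0.
-/
theorem abs_le_abs_dual_mul (t : ℝ) : |t| ≤ |dual t| * √(1 + 2 * dual t ^ 2) := by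
  have hd : ∀ x, HasDerivAt (fun x => dual x * √(1 + 2 * dual x ^ 2) - x)
      (1 / √(1 + 2 * dual x ^ 2) * √(1 + 2 * dual x ^ 2) +
        dual x * ((2 * (2 * dual x * (1 / √(1 + 2 * dual x ^ 2)))) / (2 * √(1 + 2 * dual x ^ 2)))
        - 1) x := by
    intro x
    have h0 : (1 + 2 * dual x ^ 2) ≠ 0 := by positivity
    have h1 : HasDerivAt (fun x => 1 + 2 * dual x ^ 2)
        (2 * (2 * dual x * (1 / √(1 + 2 * dual x ^ 2)))) x := by
      have := (((hasDerivAt_dual x).pow 2).const_mul 2).const_add 1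
      simpa using this
    exact ((hasDerivAt_dual x).mul (h1.sqrt h0)).sub (hasDerivAt_id x)
  have hm : Monotone fun x => dual x * √(1 + 2 * dual x ^ 2) - x := by
    apply monotone_of_deriv_nonneg (fun x => (hd x).differentiableAt)
    intro x
    rw [(hd x).deriv]
    have e : 1 / √(1 + 2 * dual x ^ 2) * √(1 + 2 * dual x ^ 2) +
        dual x * ((2 * (2 * dual x * (1 / √(1 + 2 * dual x ^ 2)))) / (2 * √(1 + 2 * dual x ^ 2)))
        - 1 = 2 * dual x ^ 2 / √(1 + 2 * dual x ^ 2) ^ 2 := by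
      field_simp
      ring
    rw [e]
    positivity
  have h := hm (abs_nonneg t)
  simp only [dual_zero, ← abs_dual, sq_abs] at h
  linarith

theorem sq_le_dual_sq_add (t : ℝ) : t ^ 2 ≤ dual t ^ 2 + 2 * dual t ^ 4 := by
  have h := pow_le_pow_left₀ (abs_nonneg t) (abs_le_abs_dual_mul t) 2
  rw [sq_abs, mul_pow, sq_abs, Real.sq_sqrt (by positivity)] at h
  linarith

theorem hasDerivAt_dual_sq (t : ℝ) :
    HasDerivAt (fun t => dual t ^ 2) (2 * (dual t / √(1 + 2 * dual t ^ 2))) t := by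
  have h := (hasDerivAt_dual t).pow 2
  have e : 2 * (dual t / √(1 + 2 * dual t ^ 2)) =
      ((2 : ℕ) : ℝ) * dual t ^ (2 - 1) * (1 / √(1 + 2 * dual t ^ 2)) := by
    norm_num
    ring
  rw [e]
  exact h

/-- With `s = f(t)` this bounds the derivative of `f²`: the square is globally Lipschitz, which
makes Sobolev's inequality usable for `f(v)²`. -/
theorem abs_div_sqrt_le (s : ℝ) : |2 * (s / √(1 + 2 * s ^ 2))| ≤ √2 := by
  have h : 0 < √(1 + 2 * s ^ 2) := by positivity
  rw [abs_mul, abs_div, abs_of_pos h, abs_two, ← mul_div_assoc, div_le_iff₀ h,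
    ← Real.sqrt_mul (by norm_num)]
  apply Real.le_sqrt_of_sq_le
  rw [mul_pow, sq_abs]
  linarith

theorem monotone_div_sqrt : Monotone fun s : ℝ => s / √(1 + 2 * s ^ 2) := by
  have hd : ∀ s : ℝ, HasDerivAt (fun s : ℝ => s / √(1 + 2 * s ^ 2))
      ((1 * √(1 + 2 * s ^ 2) - s * ((2 * (2 * s)) / (2 * √(1 + 2 * s ^ 2))))
        / √(1 + 2 * s ^ 2) ^ 2) s := by
    intro s
    have h0 : (1 + 2 * s ^ 2) ≠ 0 := by positivity
    have h1 : HasDerivAt (fun s : ℝ => 1 + 2 * s ^ 2) (2 * (2 * s)) s := by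
      have := (((hasDerivAt_id s).pow 2).const_mul 2).const_add 1
      simpa using this
    exact (hasDerivAt_id s).div (h1.sqrt h0) (by positivity)
  apply monotone_of_deriv_nonneg (fun s => (hd s).differentiableAt)
  intro s
  rw [(hd s).deriv]
  have e : 1 * √(1 + 2 * s ^ 2) - s * ((2 * (2 * s)) / (2 * √(1 + 2 * s ^ 2)))
      = 1 / √(1 + 2 * s ^ 2) := by
    have h2 : √(1 + 2 * s ^ 2) ^ 2 = 1 + 2 * s ^ 2 := Real.sq_sqrt (by positivity)
    field_simp
    linarith
  rw [e]
  positivity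

/-- The derivative `2f / √(1 + 2f²)` is a composition of monotone functions. Convexity allows
Jensen's inequality under mollification. -/
theorem convexOn_dual_sq : ConvexOn ℝ Set.univ fun t => dual t ^ 2 := by
  apply Monotone.convexOn_univ_of_deriv
  · exact fun t => (hasDerivAt_dual_sq t).differentiableAt
  · have h : deriv (fun t => dual t ^ 2) = fun t => 2 * (dual t / √(1 + 2 * dual t ^ 2)) :=
      funext fun t => (hasDerivAt_dual_sq t).deriv
    rw [h]
    exact (monotone_div_sqrt.comp monotone_dual).const_mul (by norm_num)

theorem dual_sq_le_of_abs_le {s t : ℝ} (h : |s| ≤ |t|) : dual s ^ 2 ≤ dual t ^ 2 := by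
  rw [sq_le_sq, abs_dual, abs_dual]
  exact monotone_dual h

/-! ## Mollification -/

/-- A normalized bump is a probability density, so Jensen gives `Φ(ρ ⋆ g) ≤ ρ ⋆ Φ(g)` pointwise;
integrating and using `∫ ρ = 1` gives the claim. It serves for `Φ = f²` and for `Φ = t²`. -/
theorem integral_convex_convolution_le {E : Type*} [NormedAddCommGroup E] [InnerProductSpace ℝ E]
    [FiniteDimensional ℝ E] [MeasurableSpace E] [BorelSpace E] {Φ : ℝ → ℝ}
    (hΦ : ConvexOn ℝ Set.univ Φ) (hΦc : Continuous Φ) (hΦ0 : ∀ t, 0 ≤ Φ t)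
    (b : ContDiffBump (0 : E)) {g : E → ℝ} (hg : LocallyIntegrable g)
    (hΦg : Integrable fun x => Φ (g x)) :
    Integrable (fun x => Φ ((b.normed volume ⋆[ContinuousLinearMap.lsmul ℝ ℝ, volume] g) x)) ∧
    ∫ x, Φ ((b.normed volume ⋆[ContinuousLinearMap.lsmul ℝ ℝ, volume] g) x) ≤ ∫ x, Φ (g x) := by
  set ρ : E → ℝ := b.normed volume with hρ
  have hρc : Continuous ρ := b.continuous_normed
  have hρs : HasCompactSupport ρ := b.hasCompactSupport_normed
  have hρi : Integrable ρ := b.integrable_normed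
  have hρ1 : ∫ x, ρ x = 1 := b.integral_normed
  have hρ0 : ∀ x, 0 ≤ ρ x := fun x => b.nonneg_normed x
  let k : E → NNReal := fun x => (ρ x).toNNReal
  have hk : Measurable k := hρc.measurable.real_toNNReal
  have hkρ : ∀ x, ((k x : NNReal) : ℝ) = ρ x := fun x => Real.coe_toNNReal _ (hρ0 x)
  let ν : Measure E := volume.withDensity fun x => (k x : ENNReal)
  have hν : IsProbabilityMeasure ν := by
    constructor
    rw [withDensity_apply _ MeasurableSet.univ, Measure.restrict_univ]
    have h := ofReal_integral_eq_lintegral_ofReal hρi (Eventually.of_forall hρ0)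
    rw [hρ1, ENNReal.ofReal_one] at h
    exact h.symm
  have hconv : ∀ (u : E → ℝ) (x : E),
      (ρ ⋆[ContinuousLinearMap.lsmul ℝ ℝ, volume] u) x = ∫ t, u (x - t) ∂ν := by
    intro u x
    rw [integral_withDensity_eq_integral_smul hk, convolution_def]
    refine integral_congr_ae (Eventually.of_forall fun t => ?_)
    simp [NNReal.smul_def, hkρ]
  have hint : ∀ u : E → ℝ, LocallyIntegrable u → ∀ x, Integrable (fun t => u (x - t)) ν := by
    intro u hu x
    rw [integrable_withDensity_iff_integrable_smul hk]
    have h := (hρs.convolutionExists_left (ContinuousLinearMap.lsmul ℝ ℝ) hρc hu x).integrable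
    refine h.congr (Eventually.of_forall fun t => ?_)
    simp [NNReal.smul_def, hkρ]
  have hle : ∀ x, Φ ((ρ ⋆[ContinuousLinearMap.lsmul ℝ ℝ, volume] g) x) ≤
      (ρ ⋆[ContinuousLinearMap.lsmul ℝ ℝ, volume] fun y => Φ (g y)) x := by
    intro x
    rw [hconv, hconv]
    exact hΦ.map_integral_le hΦc.continuousOn isClosed_univ (by simp) (hint g hg x)
      (hint _ hΦg.locallyIntegrable x)
  have hI : Integrable (ρ ⋆[ContinuousLinearMap.lsmul ℝ ℝ, volume] fun y => Φ (g y)) :=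
    hρi.integrable_convolution (ContinuousLinearMap.lsmul ℝ ℝ) hΦg
  have hcont : Continuous (ρ ⋆[ContinuousLinearMap.lsmul ℝ ℝ, volume] g) :=
    hρs.continuous_convolution_left (ContinuousLinearMap.lsmul ℝ ℝ) hρc hg
  have hI' : Integrable fun x => Φ ((ρ ⋆[ContinuousLinearMap.lsmul ℝ ℝ, volume] g) x) := by
    refine hI.mono' (hΦc.comp hcont).aestronglyMeasurable (Eventually.of_forall fun x => ?_)
    rw [Real.norm_of_nonneg (hΦ0 _)]
    exact hle x
  refine ⟨hI', (integral_mono hI' hI hle).trans ?_⟩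
  rw [integral_convolution (ContinuousLinearMap.lsmul ℝ ℝ) hρi hΦg, hρ1]
  simp

theorem convexOn_sq : ConvexOn ℝ Set.univ fun t : ℝ => t ^ 2 := even_two.convexOn_pow

theorem memLp_component {N : ℕ} {g : EuclideanSpace ℝ (Fin N) → EuclideanSpace ℝ (Fin N)}
    (hg : MemLp g 2 volume) (i : Fin N) : MemLp (fun x => g x i) 2 volume :=
  (EuclideanSpace.proj (𝕜 := ℝ) i).comp_memLp' hg

/-- Take `y ↦ ρ(x - y)` as test function in the definition of the weak gradient; the sign from
differentiating in `y` cancels the sign of integration by parts. -/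
theorem fderiv_mollify {N : ℕ} {v : EuclideanSpace ℝ (Fin N) → ℝ}
    {g : EuclideanSpace ℝ (Fin N) → EuclideanSpace ℝ (Fin N)} (hv : LocallyIntegrable v)
    (hvg : IsWeakGradient v g) (b : ContDiffBump (0 : EuclideanSpace ℝ (Fin N)))
    (x : EuclideanSpace ℝ (Fin N)) (i : Fin N) :
    fderiv ℝ (b.normed volume ⋆[ContinuousLinearMap.lsmul ℝ ℝ, volume] v) x
      (EuclideanSpace.single i 1) =
    (b.normed volume ⋆[ContinuousLinearMap.lsmul ℝ ℝ, volume] fun y => g y i) x := by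
  set ρ : EuclideanSpace ℝ (Fin N) → ℝ := b.normed volume with hρ
  have hρC : ContDiff ℝ ∞ ρ := b.contDiff_normed
  have hρs : HasCompactSupport ρ := b.hasCompactSupport_normed
  have hρ1 : ContDiff ℝ 1 ρ := hρC.of_le (by exact_mod_cast le_top)
  rw [(hρs.hasFDerivAt_convolution_left (ContinuousLinearMap.lsmul ℝ ℝ) hρ1 hv x).fderiv]
  have hex : ConvolutionExistsAt (fderiv ℝ ρ) v x
      ((ContinuousLinearMap.lsmul ℝ ℝ).precompL (EuclideanSpace ℝ (Fin N))) volume :=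
    (hρs.fderiv ℝ).convolutionExists_left _ (hρ1.continuous_fderiv one_ne_zero) hv x
  have hφC : ContDiff ℝ ∞ fun y => ρ (x - y) := hρC.comp (contDiff_const.sub contDiff_id)
  have hφs : HasCompactSupport fun y => ρ (x - y) :=
    hρs.comp_homeomorph (Homeomorph.subLeft x)
  have key := hvg _ hφC hφs i
  have hd : ∀ y, fderiv ℝ (fun y => ρ (x - y)) y = -fderiv ℝ ρ (x - y) := fun y => by
    have h := ((hρ1.differentiable one_ne_zero (x - y)).hasFDerivAt.comp y
      ((hasFDerivAt_id y).const_sub x)).fderiv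
    exact h.trans (by simp)
  simp only [hd, neg_apply, mul_neg, integral_neg, neg_inj] at key
  rw [convolution_eq_swap, convolution_eq_swap, ContinuousLinearMap.integral_apply]
  · simp only [ContinuousLinearMap.precompL_apply, ContinuousLinearMap.lsmul_apply, smul_eq_mul]
    simpa only [mul_comm] using key
  · exact hex.integrable_swap

theorem norm_sq_eq_sum_apply_single {N : ℕ} (L : EuclideanSpace ℝ (Fin N) →L[ℝ] ℝ) :
    ‖L‖ ^ 2 = ∑ i, L (EuclideanSpace.single i 1) ^ 2 := by
  obtain ⟨y, rfl⟩ := (InnerProductSpace.toDual ℝ (EuclideanSpace ℝ (Fin N))).surjective L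
  rw [LinearIsometryEquiv.norm_map, EuclideanSpace.norm_sq_eq]
  refine Finset.sum_congr rfl fun i _ => ?_
  simp [EuclideanSpace.inner_single_right]

theorem integral_norm_fderiv_mollify_sq_le {N : ℕ} {v : EuclideanSpace ℝ (Fin N) → ℝ}
    {g : EuclideanSpace ℝ (Fin N) → EuclideanSpace ℝ (Fin N)} (hv : LocallyIntegrable v)
    (hg : MemLp g 2 volume) (hvg : IsWeakGradient v g)
    (b : ContDiffBump (0 : EuclideanSpace ℝ (Fin N))) :
    Integrable (fun x => ‖fderiv ℝ (b.normed volume ⋆[ContinuousLinearMap.lsmul ℝ ℝ, volume] v) x‖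
      ^ 2) ∧
    ∫ x, ‖fderiv ℝ (b.normed volume ⋆[ContinuousLinearMap.lsmul ℝ ℝ, volume] v) x‖ ^ 2 ≤
      ∫ x, ‖g x‖ ^ 2 := by
  have hgi : ∀ i, Integrable fun x => g x i ^ 2 := fun i => (memLp_component hg i).integrable_sq
  have hJ := fun i => integral_convex_convolution_le convexOn_sq (continuous_pow 2)
    (fun t => sq_nonneg t) b ((memLp_component hg i).locallyIntegrable one_le_two) (hgi i)
  simp only [norm_sq_eq_sum_apply_single, fderiv_mollify hv hvg, EuclideanSpace.norm_sq_eq,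
    Real.norm_eq_abs, sq_abs]
  refine ⟨integrable_finsetSum _ fun i _ => (hJ i).1, ?_⟩
  rw [integral_finsetSum _ fun i _ => (hJ i).1, integral_finsetSum _ fun i _ => hgi i]
  exact Finset.sum_le_sum fun i _ => (hJ i).2

/-- The approximants are `χ(x/(n+1)) (ρₙ ⋆ v)`. The cutoff only decreases absolute values, hence
`f²`, and its gradient is `O(1/(n+1))`. The crude factor 2 is harmless, and `C`, which depends on
`v`, drops out in the limit. -/
theorem exists_approx {N : ℕ} {v : EuclideanSpace ℝ (Fin N) → ℝ}
    {g : EuclideanSpace ℝ (Fin N) → EuclideanSpace ℝ (Fin N)} (hv : MemLp v 2 volume)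
    (hg : MemLp g 2 volume) (hvg : IsWeakGradient v g) :
    ∃ (C : ℝ) (φ : ℕ → EuclideanSpace ℝ (Fin N) → ℝ),
      (∀ n, ContDiff ℝ 1 (φ n)) ∧ (∀ n, HasCompactSupport (φ n)) ∧
      (∀ᵐ x, Tendsto (fun n => φ n x) atTop (𝓝 (v x))) ∧
      (∀ n, ∫ x, dual (φ n x) ^ 2 ≤ ∫ x, dual (v x) ^ 2) ∧
      ∀ n, ∫ x, ‖fderiv ℝ (φ n) x‖ ^ 2 ≤ 2 * (∫ x, ‖g x‖ ^ 2) + C * (1 / ((n : ℝ) + 1)) ^ 2 := by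
  let E := EuclideanSpace ℝ (Fin N)
  let r : ℕ → ℝ := fun n => 1 / ((n : ℝ) + 1)
  have hr : ∀ n, 0 < r n := fun n => by positivity
  have hr0 : Tendsto r atTop (𝓝 0) := tendsto_one_div_add_atTop_nhds_zero_nat
  -- A fixed ratio 2 of outer to inner radius is what the almost everywhere convergence of
  -- mollifications needs (`K := 2` below).
  let b : ℕ → ContDiffBump (0 : E) := fun n => ⟨r n, 2 * r n, hr n, by linarith [hr n]⟩
  let χ : ContDiffBump (0 : E) := ⟨1, 2, one_pos, one_lt_two⟩
  let u : ℕ → E → ℝ := fun n => (b n).normed volume ⋆[ContinuousLinearMap.lsmul ℝ ℝ, volume] v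
  let c : ℕ → E → ℝ := fun n x => χ (r n • x)
  have hvl : LocallyIntegrable v := hv.locallyIntegrable one_le_two
  have hu : ∀ n, ContDiff ℝ 1 (u n) := fun n =>
    (b n).hasCompactSupport_normed.contDiff_convolution_left _ (b n).contDiff_normed hvl
  have hχ : ContDiff ℝ 1 χ := χ.contDiff
  have hc : ∀ n, ContDiff ℝ 1 (c n) := fun n => hχ.comp (contDiff_const_smul (r n))
  have hcs : ∀ n, HasCompactSupport (c n) := fun n =>
    χ.hasCompactSupport.comp_homeomorph (Homeomorph.smulOfNeZero (r n) (hr n).ne')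
  obtain ⟨M, hM⟩ := (hχ.continuous_fderiv one_ne_zero).bounded_above_of_compact_support
    (χ.hasCompactSupport.fderiv ℝ)
  have hM0 : 0 ≤ M := (norm_nonneg _).trans (hM 0)
  have hfc : ∀ n x, ‖fderiv ℝ (c n) x‖ ≤ M * r n := by
    intro n x
    have h := ((hχ.differentiable one_ne_zero (r n • x)).hasFDerivAt.comp x
      ((hasFDerivAt_id x).const_smul (r n))).fderiv
    have h' : fderiv ℝ (c n) x = r n • fderiv ℝ χ (r n • x) := h.trans (by ext; simp)
    rw [h', norm_smul, Real.norm_of_nonneg (hr n).le, mul_comm]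
    exact mul_le_mul_of_nonneg_right (hM _) (hr n).le
  have hc01 : ∀ n x, |c n x| ≤ 1 := fun n x => by
    rw [abs_of_nonneg χ.nonneg]; exact χ.le_one
  have hJf := fun n => integral_convex_convolution_le convexOn_dual_sq (continuous_dual.pow 2)
    (fun t => sq_nonneg _) (b n) hvl (hv.integrable_sq.mono'
      ((continuous_dual.pow 2).comp_aestronglyMeasurable hv.1)
      (Eventually.of_forall fun x => by
        rw [Real.norm_of_nonneg (sq_nonneg _)]; exact dual_sq_le _))
  have hJ2 := fun n => integral_convex_convolution_le convexOn_sq (continuous_pow 2)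
    (fun t => sq_nonneg t) (b n) hvl hv.integrable_sq
  have hJg := fun n => integral_norm_fderiv_mollify_sq_le hvl hg hvg (b n)
  refine ⟨2 * M ^ 2 * ∫ x, v x ^ 2, fun n x => c n x * u n x, fun n => (hc n).mul (hu n),
    fun n => (hcs n).mul_right, ?_, fun n => ?_, fun n => ?_⟩
  · have hb0 : Tendsto (fun n => (b n).rOut) atTop (𝓝 0) := by
      simpa using hr0.const_mul 2
    filter_upwards [ContDiffBump.ae_convolution_tendsto_right_of_locallyIntegrable (K := 2)
      hb0 (Eventually.of_forall fun n => le_rfl) hvl] with x hx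
    have h1 : Tendsto (fun n => c n x) atTop (𝓝 1) := by
      have h2 : Tendsto (fun n => r n • x) atTop (𝓝 0) := by
        simpa using hr0.smul_const x
      have h3 := (χ.continuous.tendsto 0).comp h2
      rwa [χ.one_of_mem_closedBall (Metric.mem_closedBall_self zero_le_one)] at h3
    simpa using h1.mul hx
  · refine le_trans (integral_mono_of_nonneg (Eventually.of_forall fun x => sq_nonneg _)
      (hJf n).1 (Eventually.of_forall fun x => dual_sq_le_of_abs_le ?_)) (hJf n).2
    rw [abs_mul]
    exact mul_le_of_le_one_left (abs_nonneg _) (hc01 n x)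
  · have hle : ∀ x, ‖fderiv ℝ (fun x => c n x * u n x) x‖ ^ 2 ≤
        2 * ‖fderiv ℝ (u n) x‖ ^ 2 + 2 * (M * r n) ^ 2 * u n x ^ 2 := by
      intro x
      rw [fderiv_fun_mul ((hc n).differentiable one_ne_zero x)
        ((hu n).differentiable one_ne_zero x)]
      have h1 : ‖c n x • fderiv ℝ (u n) x‖ ≤ ‖fderiv ℝ (u n) x‖ := by
        rw [norm_smul]
        exact mul_le_of_le_one_left (norm_nonneg _) (hc01 n x)
      have h2 : ‖u n x • fderiv ℝ (c n) x‖ ≤ |u n x| * (M * r n) := by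
        rw [norm_smul]
        exact mul_le_mul_of_nonneg_left (hfc n x) (abs_nonneg _)
      have h3 := (norm_add_le _ _).trans (add_le_add h1 h2)
      refine (pow_le_pow_left₀ (norm_nonneg _) h3 2).trans ?_
      refine (add_sq_le).trans (le_of_eq ?_)
      rw [mul_pow, sq_abs]
      ring
    have hI := ((hJg n).1.const_mul 2).add ((hJ2 n).1.const_mul (2 * (M * r n) ^ 2))
    refine (integral_mono_of_nonneg (Eventually.of_forall fun x => sq_nonneg _) hI
      (Eventually.of_forall hle)).trans ?_
    simp only [Pi.add_apply]
    rw [integral_add ((hJg n).1.const_mul 2) ((hJ2 n).1.const_mul (2 * (M * r n) ^ 2)),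
      integral_const_mul, integral_const_mul]
    have h4 := mul_le_mul_of_nonneg_left (hJ2 n).2 (by positivity : 0 ≤ 2 * (M * r n) ^ 2)
    have h5 := mul_le_mul_of_nonneg_left (hJg n).2 (by norm_num : (0 : ℝ) ≤ 2)
    refine (add_le_add h5 h4).trans (le_of_eq ?_)
    simp only [r]
    ring

/-! ## A Gagliardo–Nirenberg inequality for the dual function -/

theorem eLpNorm_two_eq {α F : Type*} [MeasurableSpace α] {μ : Measure α} [NormedAddCommGroup F]
    {f : α → F} (hf : Integrable (fun x => ‖f x‖ ^ 2) μ) :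
    eLpNorm f 2 μ = ENNReal.ofReal (∫ x, ‖f x‖ ^ 2 ∂μ) ^ (1 / 2 : ℝ) := by
  rw [eLpNorm_eq_lintegral_rpow_enorm_toReal two_ne_zero ENNReal.ofNat_ne_top,
    ofReal_integral_eq_lintegral_ofReal hf (Eventually.of_forall fun x => sq_nonneg _)]
  simp only [ENNReal.toReal_ofNat]
  congr 1
  refine lintegral_congr fun x => ?_
  rw [ENNReal.ofReal_pow (norm_nonneg _), ofReal_norm]
  norm_cast

theorem integrable_norm_sq_of_hasCompactSupport {X F : Type*} [TopologicalSpace X]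
    [MeasurableSpace X] [OpensMeasurableSpace X] {μ : Measure X} [IsFiniteMeasureOnCompacts μ]
    [NormedAddCommGroup F] {f : X → F} (hf : Continuous f) (hfs : HasCompactSupport f) :
    Integrable (fun x => ‖f x‖ ^ 2) μ := by
  simp only [pow_two]
  exact (hf.norm.mul hf.norm).integrable_of_hasCompactSupport hfs.norm.mul_left

theorem fderiv_dual_sq_norm_le {E : Type*} [NormedAddCommGroup E] [NormedSpace ℝ E] {φ : E → ℝ}
    {x : E} (hφ : DifferentiableAt ℝ φ x) :
    ‖fderiv ℝ (fun x => dual (φ x) ^ 2) x‖ ≤ √2 * ‖fderiv ℝ φ x‖ := by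
  have h := ((hasDerivAt_dual_sq (φ x)).comp_hasFDerivAt x hφ.hasFDerivAt).fderiv
  have h' : fderiv ℝ (fun x => dual (φ x) ^ 2) x =
    (2 * (dual (φ x) / √(1 + 2 * dual (φ x) ^ 2))) • fderiv ℝ φ x := h
  rw [h', norm_smul]
  exact mul_le_mul_of_nonneg_right (abs_div_sqrt_le _) (norm_nonneg _)

/-- `P` is the Sobolev exponent `2N/(N-2)`, and `a`, `s` are the interpolation weights of `p/2`
between 1 and `P`. As `P s = (p - 2)N/(N + 2)`, the bound `P s < 2` is the condition `p < 4 + 4/N`.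
-/
theorem exists_exponents {N : ℕ} (hN : 4 ≤ N) {p : ℝ} (hp₁ : 2 < p) (hp₂ : p < 4 + 4 / (N : ℝ)) :
    ∃ (P : NNReal) (a s : ℝ), 1 ≤ P ∧ (P : ℝ)⁻¹ = (2 : ℝ)⁻¹ - (N : ℝ)⁻¹ ∧ 0 ≤ a ∧ 0 < s ∧
      a + s = 1 ∧ p / 2 = a + P * s ∧ P * s < 2 := by
  have hN' : (4 : ℝ) ≤ N := by exact_mod_cast hN
  have hN2 : (0 : ℝ) < N - 2 := by linarith
  have hN0 : (0 : ℝ) < N := by linarith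
  have hp : p * N < 4 * N + 4 := by
    have h := mul_lt_mul_of_pos_right hp₂ hN0
    rwa [add_mul, div_mul_cancel₀ _ hN0.ne'] at h
  let P : NNReal := ⟨2 * N / (N - 2), by positivity⟩
  -- This solves `p/2 = (1 - s) + P s`, since `P - 1 = (N + 2)/(N - 2)`.
  let s : ℝ := (p / 2 - 1) * (N - 2) / (N + 2)
  have hs : 0 < s := by
    have : 0 < p / 2 - 1 := by linarith
    positivity
  have hP : (P : ℝ) = 2 * N / (N - 2) := rfl
  have hP1 : (1 : ℝ) ≤ P := by
    rw [hP, one_le_div hN2]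
    linarith
  have hPs : (P : ℝ) * s = (p - 2) * N / (N + 2) := by
    rw [hP]
    simp only [s]
    field_simp
  refine ⟨P, 1 - s, s, by exact_mod_cast hP1, ?_, ?_, hs, by ring, ?_, ?_⟩
  · rw [hP]
    field_simp
  · rw [sub_nonneg]
    simp only [s]
    rw [div_le_one (by linarith)]
    nlinarith
  · rw [hPs]
    simp only [s]
    field_simp
    ring
  · rw [hPs, div_lt_iff₀ (by linarith)]
    linarith

theorem exists_gagliardoNirenberg_contDiff {N : ℕ} (hN : 4 ≤ N) {p : ℝ} (hp₁ : 2 < p)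
    (hp₂ : p < 4 + 4 / (N : ℝ)) :
    ∃ (K : NNReal) (a θ : ℝ), 0 ≤ a ∧ 0 < θ ∧ θ < 1 ∧
      ∀ φ : EuclideanSpace ℝ (Fin N) → ℝ, ContDiff ℝ 1 φ → HasCompactSupport φ →
        ∫⁻ x, ‖dual (φ x)‖ₑ ^ p ≤ ENNReal.ofReal (∫ x, dual (φ x) ^ 2) ^ a *
          (K * ENNReal.ofReal (∫ x, ‖fderiv ℝ φ x‖ ^ 2)) ^ θ := by
  obtain ⟨P, a, s, hP1, hP, ha, hs, has, hpa, hPs⟩ := exists_exponents hN hp₁ hp₂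
  have hP0 : (0 : ℝ) < P := lt_of_lt_of_le one_pos (by exact_mod_cast hP1)
  let S : NNReal :=
    SNormLESNormFDerivOfEqConst ℝ (volume : Measure (EuclideanSpace ℝ (Fin N))) 2
  refine ⟨(S * NNReal.sqrt 2) ^ 2, a, P * s / 2, ha, by positivity, by linarith,
    fun φ hφ hφs => ?_⟩
  set w : EuclideanSpace ℝ (Fin N) → ℝ := fun x => dual (φ x) ^ 2 with hw
  have hwC : ContDiff ℝ 1 w := (contDiff_dual.comp hφ).pow 2
  have hws : HasCompactSupport w := hφs.comp_left (g := fun t => dual t ^ 2) (by simp [dual_zero])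
  have hwi : Integrable w := hwC.continuous.integrable_of_hasCompactSupport hws
  have hW : ∫⁻ x, ‖w x‖ₑ = ENNReal.ofReal (∫ x, dual (φ x) ^ 2) := by
    rw [ofReal_integral_eq_lintegral_ofReal hwi (Eventually.of_forall fun x => sq_nonneg _)]
    exact lintegral_congr fun x => Real.enorm_of_nonneg (sq_nonneg _)
  have hsplit : ∀ x, ‖dual (φ x)‖ₑ ^ p = ‖w x‖ₑ ^ a * (‖w x‖ₑ ^ (P : ℝ)) ^ s := by
    intro x
    rw [← ENNReal.rpow_mul, ← ENNReal.rpow_add_of_nonneg _ _ ha (by positivity), ← hpa]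
    simp only [hw]
    rw [enorm_pow, ← ENNReal.rpow_natCast, ← ENNReal.rpow_mul]
    congr 1
    push_cast
    ring
  have hm : Measurable fun x => ‖w x‖ₑ := hwC.continuous.measurable.enorm
  have hmP : Measurable fun x => ‖w x‖ₑ ^ (P : ℝ) := hm.pow_const _
  have hsob : eLpNorm w P volume ≤ S * eLpNorm (fderiv ℝ w) 2 volume := by
    have h := eLpNorm_le_eLpNorm_fderiv_of_eq (F := ℝ) (volume : Measure (EuclideanSpace ℝ (Fin N)))
      hwC hws (p := 2) (p' := P) one_le_two (by simp; omega) (by simpa using hP)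
    simpa using h
  have hgrad : eLpNorm (fderiv ℝ w) 2 volume ≤
      NNReal.sqrt 2 * ENNReal.ofReal (∫ x, ‖fderiv ℝ φ x‖ ^ 2) ^ (1 / 2 : ℝ) := by
    rw [← eLpNorm_two_eq]
    · refine eLpNorm_le_nnreal_smul_eLpNorm_of_ae_le_mul (Eventually.of_forall fun x => ?_) 2
      have h := fderiv_dual_sq_norm_le (hφ.differentiable one_ne_zero x)
      refine NNReal.coe_le_coe.1 ?_
      rw [NNReal.coe_mul, Real.coe_sqrt]
      exact h
    · exact integrable_norm_sq_of_hasCompactSupport (hφ.continuous_fderiv one_ne_zero)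
        (hφs.fderiv ℝ)
  have hPe : ∫⁻ x, ‖w x‖ₑ ^ (P : ℝ) = eLpNorm w P volume ^ (P : ℝ) := by
    rw [eLpNorm_eq_lintegral_rpow_enorm_toReal (by exact_mod_cast hP0.ne') ENNReal.coe_ne_top,
      ← ENNReal.rpow_mul]
    simp [hP0.ne']
  simp only [hsplit]
  -- Hölder's inequality with weights `a + s = 1` applied to `w` and `w^P`.
  refine (ENNReal.lintegral_mul_norm_pow_le hm.aemeasurable hmP.aemeasurable ha hs.le has).trans ?_
  rw [hPe, ← ENNReal.rpow_mul]
  refine mul_le_mul' (by rw [hW]) ?_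
  refine (ENNReal.rpow_le_rpow (hsob.trans (mul_le_mul_right hgrad _)) (by positivity)).trans
    (le_of_eq ?_)
  have h2 : (P : ℝ) * s = ((2 : ℕ) : ℝ) * (P * s / 2) := by push_cast; ring
  rw [h2, ENNReal.rpow_mul, ENNReal.rpow_natCast, ← mul_assoc, mul_pow,
    ← ENNReal.rpow_natCast (ENNReal.ofReal _ ^ (1 / 2 : ℝ)), ← ENNReal.rpow_mul]
  norm_num

theorem exists_gagliardoNirenberg {N : ℕ} (hN : 4 ≤ N) {p : ℝ} (hp₁ : 2 < p)
    (hp₂ : p < 4 + 4 / (N : ℝ)) :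
    ∃ (K : NNReal) (a θ : ℝ), 0 ≤ a ∧ 0 < θ ∧ θ < 1 ∧
      ∀ (v : EuclideanSpace ℝ (Fin N) → ℝ)
        (g : EuclideanSpace ℝ (Fin N) → EuclideanSpace ℝ (Fin N)),
        MemLp v 2 volume → MemLp g 2 volume → IsWeakGradient v g →
        ∫⁻ x, ‖dual (v x)‖ₑ ^ p ≤ ENNReal.ofReal (∫ x, dual (v x) ^ 2) ^ a *
          (K * ENNReal.ofReal (2 * ∫ x, ‖g x‖ ^ 2)) ^ θ := by
  obtain ⟨K, a, θ, ha, hθ, hθ1, hK⟩ := exists_gagliardoNirenberg_contDiff hN hp₁ hp₂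
  refine ⟨K, a, θ, ha, hθ, hθ1, fun v g hv hg hvg => ?_⟩
  obtain ⟨C, φ, hφ, hφs, hlim, hA, hD⟩ := exists_approx hv hg hvg
  have hle : ∀ n, ∫⁻ x, ‖dual (φ n x)‖ₑ ^ p ≤ ENNReal.ofReal (∫ x, dual (v x) ^ 2) ^ a *
      (K * ENNReal.ofReal (2 * (∫ x, ‖g x‖ ^ 2) + C * (1 / ((n : ℝ) + 1)) ^ 2)) ^ θ := by
    intro n
    refine (hK (φ n) (hφ n) (hφs n)).trans ?_
    exact mul_le_mul' (ENNReal.rpow_le_rpow (ENNReal.ofReal_le_ofReal (hA n)) ha)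
      (ENNReal.rpow_le_rpow (mul_le_mul_right (ENNReal.ofReal_le_ofReal (hD n)) _) hθ.le)
  have hlim' : ∀ᵐ x, ‖dual (v x)‖ₑ ^ p = liminf (fun n => ‖dual (φ n x)‖ₑ ^ p) atTop := by
    filter_upwards [hlim] with x hx
    have h := ((ENNReal.continuous_rpow_const (y := p)).tendsto _).comp
      ((continuous_dual.enorm.tendsto _).comp hx)
    exact h.liminf_eq.symm
  -- Fatou's lemma; the bounds on the right converge as the cutoff error vanishes.
  rw [lintegral_congr_ae hlim']
  refine (lintegral_liminf_le fun n =>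
    ((continuous_dual.comp (hφ n).continuous).enorm.measurable.pow_const p)).trans ?_
  refine (liminf_le_liminf (Eventually.of_forall hle)).trans (le_of_eq ?_)
  apply Tendsto.liminf_eq
  have h1 : Tendsto (fun n : ℕ => 2 * (∫ x, ‖g x‖ ^ 2) + C * (1 / ((n : ℝ) + 1)) ^ 2) atTop
      (𝓝 (2 * ∫ x, ‖g x‖ ^ 2)) := by
    simpa using ((tendsto_one_div_add_atTop_nhds_zero_nat (𝕜 := ℝ)).pow 2).const_mul C
      |>.const_add (2 * ∫ x, ‖g x‖ ^ 2)
  refine ENNReal.Tendsto.const_mul ?_ (Or.inr ?_)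
  · refine ((ENNReal.continuous_rpow_const (y := θ)).tendsto _).comp ?_
    exact ENNReal.Tendsto.const_mul (ENNReal.tendsto_ofReal h1) (Or.inr ENNReal.coe_ne_top)
  · exact ENNReal.rpow_ne_top_of_nonneg ha ENNReal.ofReal_ne_top

/-! ## The constraint set is nonempty -/

theorem memH1_of_contDiff {N : ℕ} {ψ : EuclideanSpace ℝ (Fin N) → ℝ} (hψ : ContDiff ℝ 1 ψ)
    (hψs : HasCompactSupport ψ) : MemH1 ψ := by
  have hc' : Continuous (fderiv ℝ ψ) := hψ.continuous_fderiv one_ne_zero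
  let J := (InnerProductSpace.toDual ℝ (EuclideanSpace ℝ (Fin N))).symm
  have hgc : Continuous fun x => J (fderiv ℝ ψ x) := J.continuous.comp hc'
  have hgs : HasCompactSupport fun x => J (fderiv ℝ ψ x) :=
    (hψs.fderiv ℝ).comp_left (g := J) (map_zero J)
  refine ⟨hψ.continuous.memLp_of_hasCompactSupport hψs, fun x => J (fderiv ℝ ψ x),
    hgc.memLp_of_hasCompactSupport hgs, fun φ hφ hφs i => ?_⟩
  have hi : ∀ x, J (fderiv ℝ ψ x) i = fderiv ℝ ψ x (EuclideanSpace.single i 1) := by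
    intro x
    have h : inner ℝ (J (fderiv ℝ ψ x)) (EuclideanSpace.single i (1 : ℝ)) =
        fderiv ℝ ψ x (EuclideanSpace.single i 1) := InnerProductSpace.toDual_symm_apply
    rw [← h, EuclideanSpace.inner_single_right]
    simp
  simp only [hi]
  have hφ1 : ContDiff ℝ 1 φ := hφ.of_le (by exact_mod_cast le_top)
  have hdψ : Continuous fun x => fderiv ℝ ψ x (EuclideanSpace.single i 1) :=
    hc'.clm_apply continuous_const
  have hdφ : Continuous fun x => fderiv ℝ φ x (EuclideanSpace.single i 1) :=
    (hφ1.continuous_fderiv one_ne_zero).clm_apply continuous_const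
  exact integral_mul_fderiv_eq_neg_fderiv_mul_of_integrable
    ((hdψ.mul hφ1.continuous).integrable_of_hasCompactSupport hφs.mul_left)
    ((hψ.continuous.mul hdφ).integrable_of_hasCompactSupport hψs.mul_right)
    ((hψ.continuous.mul hφ1.continuous).integrable_of_hasCompactSupport hφs.mul_left)
    (fun x _ => hψ.differentiable one_ne_zero x) (fun x _ => hφ1.differentiable one_ne_zero x)

/-- The squared norm of the `k`-th block of coordinates. -/
noncomputable def blockNormSq {N : ℕ} (m : ℕ) (k : Fin 3) (x : EuclideanSpace ℝ (Fin N)) : ℝ :=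
  ∑ i, if blockIndex m i = k then x i ^ 2 else 0

theorem mulVec_dotProduct_mulVec {N : ℕ} (A : Matrix.orthogonalGroup (Fin N) ℝ) (y : Fin N → ℝ) :
    (A.1.mulVec y) ⬝ᵥ (A.1.mulVec y) = y ⬝ᵥ y := by
  have h : A.1.transpose * A.1 = 1 := by
    have := Matrix.UnitaryGroup.star_mul_self A
    rwa [Matrix.star_eq_conjTranspose, Matrix.conjTranspose_eq_transpose_of_trivial] at this
  rw [Matrix.dotProduct_mulVec, ← Matrix.mulVec_transpose, Matrix.mulVec_mulVec, h,
    Matrix.one_mulVec]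

theorem norm_toEuclideanLin {N : ℕ} (A : Matrix.orthogonalGroup (Fin N) ℝ)
    (x : EuclideanSpace ℝ (Fin N)) : ‖Matrix.toEuclideanLin A.1 x‖ = ‖x‖ := by
  have h := mulVec_dotProduct_mulVec A x.ofLp
  rw [← sq_eq_sq₀ (norm_nonneg _) (norm_nonneg _), EuclideanSpace.norm_sq_eq,
    EuclideanSpace.norm_sq_eq]
  simpa [dotProduct, pow_two] using h

/-- A block diagonal matrix commutes with truncation to the `k`-th block, and orthogonality
preserves the norm of the truncated vector. -/
theorem blockNormSq_toEuclideanLin {N m : ℕ} {A : Matrix.orthogonalGroup (Fin N) ℝ}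
    (hA : A ∈ blockGroup N m) (k : Fin 3) (x : EuclideanSpace ℝ (Fin N)) :
    blockNormSq m k (Matrix.toEuclideanLin A.1 x) = blockNormSq m k x := by
  let y : Fin N → ℝ := fun j => if blockIndex m j = k then x j else 0
  have hA' : ∀ i j : Fin N, blockIndex m i ≠ blockIndex m j → A.1 i j = 0 := hA
  have hAy : ∀ i, A.1.mulVec y i = if blockIndex m i = k then A.1.mulVec x.ofLp i else 0 := by
    intro i
    simp only [Matrix.mulVec, dotProduct]
    split_ifs with hi
    · refine Finset.sum_congr rfl fun j _ => ?_
      by_cases hj : blockIndex m j = k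
      · simp [y, hj]
      · rw [hA' i j (fun h => hj (h ▸ hi)), zero_mul, zero_mul]
    · refine Finset.sum_eq_zero fun j _ => ?_
      by_cases hj : blockIndex m j = k
      · rw [hA' i j (fun h => hi (h.trans hj)), zero_mul]
      · simp [y, hj]
  have h := mulVec_dotProduct_mulVec A y
  simp only [dotProduct, hAy, ← pow_two] at h
  simpa [blockNormSq, y, ite_pow] using h

theorem tau_apply (N m : ℕ) (x : EuclideanSpace ℝ (Fin N)) (i : Fin N) :
    tau N m x i = x (swapIndex N m i) := rfl

theorem blockIndex_swapIndex {N m : ℕ} (hmN : 2 * m ≤ N) (i : Fin N) :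
    (blockIndex m (swapIndex N m i) = 0 ↔ blockIndex m i = 1) ∧
    (blockIndex m (swapIndex N m i) = 1 ↔ blockIndex m i = 0) := by
  have hi := i.isLt
  have b0 : ∀ j : Fin N, blockIndex m j = 0 ↔ j.val < m := by
    intro j
    unfold blockIndex
    split_ifs <;> simp [*]
  have b1 : ∀ j : Fin N, blockIndex m j = 1 ↔ m ≤ j.val ∧ j.val < 2 * m := by
    intro j
    unfold blockIndex
    split_ifs <;> simp <;> omega
  have hs : (swapIndex N m i).val =
      if i.val < m then i.val + m else if i.val < 2 * m then i.val - m else i.val := by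
    unfold swapIndex
    split_ifs <;> first | rfl | omega
  rw [b0, b0, b1, b1, hs]
  constructor <;> (split_ifs <;> omega)

theorem blockNormSq_tau {N m : ℕ} (hmN : 2 * m ≤ N) (x : EuclideanSpace ℝ (Fin N)) :
    blockNormSq m 0 (tau N m x) = blockNormSq m 1 x ∧
    blockNormSq m 1 (tau N m x) = blockNormSq m 0 x := by
  let σ := (swapIndex_involutive N m).toPerm
  constructor
  · rw [blockNormSq, blockNormSq,
      ← Equiv.sum_comp σ fun i => if blockIndex m i = 1 then x i ^ 2 else 0]
    refine Finset.sum_congr rfl fun i _ => ?_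
    have h := (blockIndex_swapIndex hmN i).2
    simp only [tau_apply, σ, Function.Involutive.coe_toPerm, h]
  · rw [blockNormSq, blockNormSq,
      ← Equiv.sum_comp σ fun i => if blockIndex m i = 0 then x i ^ 2 else 0]
    refine Finset.sum_congr rfl fun i _ => ?_
    have h := (blockIndex_swapIndex hmN i).1
    simp only [tau_apply, σ, Function.Involutive.coe_toPerm, h]

/-- A smooth compactly supported function with the symmetries of `YG`. -/
noncomputable def symmetricBump (N m : ℕ) (x : EuclideanSpace ℝ (Fin N)) : ℝ :=
  (blockNormSq m 0 x - blockNormSq m 1 x) * Real.smoothTransition (2 - ‖x‖ ^ 2)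

theorem contDiff_blockNormSq {N : ℕ} (m : ℕ) (k : Fin 3) :
    ContDiff ℝ 1 (blockNormSq (N := N) m k) := by
  unfold blockNormSq
  refine ContDiff.sum fun i _ => ?_
  split_ifs
  · exact (EuclideanSpace.proj (𝕜 := ℝ) i).contDiff.pow 2
  · exact contDiff_const

theorem contDiff_symmetricBump (N m : ℕ) : ContDiff ℝ 1 (symmetricBump N m) :=
  ((contDiff_blockNormSq m 0).sub (contDiff_blockNormSq m 1)).mul
    (Real.smoothTransition.contDiff.comp (contDiff_const.sub (contDiff_norm_sq ℝ)))

theorem hasCompactSupport_symmetricBump (N m : ℕ) : HasCompactSupport (symmetricBump N m) := by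
  refine HasCompactSupport.intro (isCompact_closedBall (0 : EuclideanSpace ℝ (Fin N)) 2)
    fun x hx => ?_
  rw [mem_closedBall_zero_iff, not_le] at hx
  rw [symmetricBump, Real.smoothTransition.zero_of_nonpos (by nlinarith), mul_zero]

theorem symmetricBump_toEuclideanLin {N m : ℕ} {A : Matrix.orthogonalGroup (Fin N) ℝ}
    (hA : A ∈ blockGroup N m) (x : EuclideanSpace ℝ (Fin N)) :
    symmetricBump N m (Matrix.toEuclideanLin A.1 x) = symmetricBump N m x := by
  simp only [symmetricBump, blockNormSq_toEuclideanLin hA, norm_toEuclideanLin]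

theorem symmetricBump_tau {N m : ℕ} (hmN : 2 * m ≤ N) (x : EuclideanSpace ℝ (Fin N)) :
    symmetricBump N m (tau N m x) = -symmetricBump N m x := by
  simp only [symmetricBump, (blockNormSq_tau hmN x).1, (blockNormSq_tau hmN x).2,
    LinearIsometryEquiv.norm_map]
  ring

theorem symmetricBump_single {N m : ℕ} (hm : 0 < m) (i : Fin N) (hi : i.val = 0) :
    symmetricBump N m (EuclideanSpace.single i 1) = 1 := by
  have hb : blockIndex m i = 0 := by simp [blockIndex, hi, hm]
  have hB : ∀ k : Fin 3, blockNormSq m k (EuclideanSpace.single i (1 : ℝ)) =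
      if blockIndex m i = k then 1 else 0 := by
    intro k
    rw [blockNormSq, Finset.sum_eq_single i]
    · simp
    · intro j _ hj
      simp [hj]
    · simp
  rw [symmetricBump, hB, hB, hb, Real.smoothTransition.one_of_one_le (by norm_num)]
  simp

/-- Dilation by `R` multiplies `∫ f(ψ)²` by `R^N` and commutes with the linear symmetries, so `R^N =
lam / B` adjusts the constraint. -/
theorem constraintSet_nonempty {N m : ℕ} (hm : 0 < m) (hmN : 2 * m ≤ N) {lam : ℝ}
    (hlam : 0 < lam) : (constraintSet N m lam).Nonempty := by
  have hN : 0 < N := by omega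
  have hC := contDiff_symmetricBump N m
  have hs := hasCompactSupport_symmetricBump N m
  set B : ℝ := ∫ x, |dual (symmetricBump N m x)| ^ 2 with hB
  have hB0 : 0 < B := by
    refine Continuous.integral_pos_of_hasCompactSupport_nonneg_nonzero
      (x := EuclideanSpace.single ⟨0, hN⟩ 1) ?_ ?_ (fun x => by positivity) ?_
    · exact (continuous_dual.comp hC.continuous).abs.pow 2
    · exact hs.comp_left (g := fun t => |dual t| ^ 2) (by simp [dual_zero])
    · rw [symmetricBump_single hm _ rfl]
      exact pow_ne_zero 2 (abs_ne_zero.2 (dual_ne_zero one_ne_zero))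
  let R : ℝ := (lam / B) ^ (1 / (N : ℝ))
  have hR : 0 < R := by positivity
  have hRN : R ^ N = lam / B := by
    simp only [R]
    rw [← Real.rpow_natCast, ← Real.rpow_mul (by positivity),
      one_div_mul_cancel (by exact_mod_cast hN.ne'), Real.rpow_one]
  refine ⟨fun x => symmetricBump N m (R⁻¹ • x), ⟨⟨?_, fun A hA => ?_, ?_⟩, ?_⟩⟩
  · exact memH1_of_contDiff (hC.comp (contDiff_const_smul R⁻¹))
      (hs.comp_homeomorph (Homeomorph.smulOfNeZero R⁻¹ (inv_ne_zero hR.ne')))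
  · refine Eventually.of_forall fun x => ?_
    simp only [← map_smul, symmetricBump_toEuclideanLin hA]
  · refine Eventually.of_forall fun x => ?_
    simp only [← map_smul, symmetricBump_tau hmN]
  · rw [Measure.integral_comp_inv_smul_of_nonneg volume
      (fun x => |dual (symmetricBump N m x)| ^ 2) hR.le, finrank_euclideanSpace_fin, hRN, ← hB,
      smul_eq_mul, div_mul_cancel₀ _ hB0.ne']

/-! ## Coercivity -/

theorem integrable_dual_sq {N : ℕ} {v : EuclideanSpace ℝ (Fin N) → ℝ} (hv : MemLp v 2 volume) :
    Integrable fun x => dual (v x) ^ 2 :=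
  hv.integrable_sq.mono' ((continuous_dual.pow 2).comp_aestronglyMeasurable hv.1)
    (Eventually.of_forall fun x => by
      rw [Real.norm_of_nonneg (sq_nonneg _)]; exact dual_sq_le _)

theorem exists_integral_abs_dual_rpow_le {N : ℕ} (hN : 4 ≤ N) {p : ℝ} (hp₁ : 2 < p)
    (hp₂ : p < 4 + 4 / (N : ℝ)) (lam : ℝ) :
    ∃ M θ : ℝ, 0 ≤ M ∧ 0 < θ ∧ θ < 1 ∧ ∀ v : EuclideanSpace ℝ (Fin N) → ℝ, MemH1 v →
      ∫ x, dual (v x) ^ 2 = lam →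
      Integrable (fun x => |dual (v x)| ^ p) ∧
        ∫ x, |dual (v x)| ^ p ≤ M * (∫ x, ‖weakGradient v x‖ ^ 2) ^ θ := by
  obtain ⟨K, a, θ, ha, hθ, hθ1, hK⟩ := exists_gagliardoNirenberg hN hp₁ hp₂
  -- The maximum keeps the constant nonnegative when `lam < 0`, where no `v` qualifies; the factor 2
  -- is the loss in the approximation.
  refine ⟨(max lam 0) ^ a * (K * 2) ^ θ, θ, by positivity, hθ, hθ1, fun v hv hlam => ?_⟩
  have h := hK v _ hv.1 hv.weakGradient_spec.1 hv.weakGradient_spec.2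
  set D := ∫ x, ‖weakGradient v x‖ ^ 2 with hD
  have hD0 : 0 ≤ D := integral_nonneg fun x => sq_nonneg _
  have hlam0 : 0 ≤ lam := hlam ▸ integral_nonneg fun x => sq_nonneg _
  have hp0 : 0 ≤ p := by linarith
  rw [hlam, ENNReal.ofReal_rpow_of_nonneg hlam0 ha, ← ENNReal.ofReal_coe_nnreal (p := K),
    ← ENNReal.ofReal_mul K.coe_nonneg, ENNReal.ofReal_rpow_of_nonneg (by positivity) hθ.le,
    ← ENNReal.ofReal_mul (by positivity), ← mul_assoc, Real.mul_rpow (by positivity) hD0,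
    ← mul_assoc] at h
  rw [max_eq_left hlam0]
  have hm : AEStronglyMeasurable (fun x => |dual (v x)| ^ p) volume :=
    (continuous_dual.abs.rpow_const fun _ => Or.inr hp0).comp_aestronglyMeasurable hv.1.1
  have he : ∀ x, ENNReal.ofReal (|dual (v x)| ^ p) = ‖dual (v x)‖ₑ ^ p := fun x => by
    rw [← ENNReal.ofReal_rpow_of_nonneg (abs_nonneg _) hp0, ← Real.norm_eq_abs, ofReal_norm]
  have hnn : ∀ x, 0 ≤ |dual (v x)| ^ p := fun x => by positivity
  constructor
  · refine ⟨hm, ?_⟩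
    rw [hasFiniteIntegral_iff_ofReal (Eventually.of_forall hnn)]
    simp only [he]
    exact h.trans_lt ENNReal.ofReal_lt_top
  · rw [integral_eq_lintegral_of_nonneg_ae (Eventually.of_forall hnn) hm]
    simp only [he]
    exact ENNReal.toReal_le_of_le_ofReal (by positivity) h

/-- Young's inequality: weighted AM-GM for `D/4` and `Y` with weights `θ` and `1 - θ`, where `Y` is
chosen so that `Y^(1-θ) = 4^θ M`. -/
theorem exists_mul_rpow_le {M θ : ℝ} (hM : 0 ≤ M) (hθ : 0 < θ) (hθ1 : θ < 1) :
    ∃ C, ∀ D : ℝ, 0 ≤ D → M * D ^ θ ≤ D / 4 + C := by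
  let Y : ℝ := (4 ^ θ * M) ^ (1 / (1 - θ))
  have hθ' : 0 < 1 - θ := by linarith
  have hY : 0 ≤ Y := by positivity
  refine ⟨Y, fun D hD => ?_⟩
  have h := Real.geom_mean_le_arith_mean2_weighted hθ.le hθ'.le
    (by positivity : 0 ≤ D / 4) hY (by ring)
  have hYp : Y ^ (1 - θ) = 4 ^ θ * M := by
    simp only [Y]
    rw [← Real.rpow_mul (by positivity), one_div_mul_cancel hθ'.ne', Real.rpow_one]
  rw [hYp, Real.div_rpow hD (by norm_num)] at h
  have h4 : (4 : ℝ) ^ θ ≠ 0 := by positivity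
  have e : D ^ θ / 4 ^ θ * (4 ^ θ * M) = M * D ^ θ := by
    field_simp
  rw [e] at h
  nlinarith

theorem exists_gradient_le_energy {N : ℕ} (hN : 4 ≤ N) {p : ℝ} (hp₁ : 2 < p)
    (hp₂ : p < 4 + 4 / (N : ℝ)) (lam : ℝ) :
    ∃ C : ℝ, ∀ v : EuclideanSpace ℝ (Fin N) → ℝ, MemH1 v → ∫ x, dual (v x) ^ 2 = lam →
      (∫ x, ‖weakGradient v x‖ ^ 2) / 4 ≤ energy p v + C := by
  obtain ⟨M, θ, hM, hθ, hθ1, h⟩ := exists_integral_abs_dual_rpow_le hN hp₁ hp₂ lam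
  have hp0 : 0 < p := by linarith
  obtain ⟨C, hC⟩ := exists_mul_rpow_le (by positivity : 0 ≤ 1 / p * M) hθ hθ1
  refine ⟨C, fun v hv hlam => ?_⟩
  have h1 := mul_le_mul_of_nonneg_left (h v hv hlam).2 (by positivity : 0 ≤ 1 / p)
  have h2 := hC (∫ x, ‖weakGradient v x‖ ^ 2) (integral_nonneg fun x => sq_nonneg _)
  rw [energy]
  linarith

theorem exists_integral_sq_le {N : ℕ} (hN : 4 ≤ N) (lam : ℝ) :
    ∃ C : ℝ, ∀ v : EuclideanSpace ℝ (Fin N) → ℝ, MemH1 v → ∫ x, dual (v x) ^ 2 = lam →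
      ∫ x, v x ^ 2 ≤ (∫ x, ‖weakGradient v x‖ ^ 2) / 4 + C := by
  have hN0 : (0 : ℝ) < N := by exact_mod_cast (by omega : 0 < N)
  have hp₂ : (4 : ℝ) < 4 + 4 / (N : ℝ) := by
    have : 0 < 4 / (N : ℝ) := by positivity
    linarith
  obtain ⟨M, θ, hM, hθ, hθ1, h⟩ := exists_integral_abs_dual_rpow_le hN (by norm_num) hp₂ lam
  obtain ⟨C, hC⟩ := exists_mul_rpow_le (by positivity : 0 ≤ 2 * M) hθ hθ1
  refine ⟨lam + C, fun v hv hlam => ?_⟩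
  obtain ⟨hi4, h4⟩ := h v hv hlam
  have he : ∀ x, |dual (v x)| ^ (4 : ℝ) = dual (v x) ^ 4 := fun x => by
    rw [← Even.pow_abs (by decide : Even 4) (dual (v x))]
    exact_mod_cast Real.rpow_natCast |dual (v x)| 4
  simp only [he] at hi4 h4
  have hi2 := integrable_dual_sq hv.1
  have h5 : ∫ x, v x ^ 2 ≤ ∫ x, (dual (v x) ^ 2 + 2 * dual (v x) ^ 4) :=
    integral_mono hv.1.integrable_sq (hi2.add (hi4.const_mul 2)) fun x => sq_le_dual_sq_add _
  rw [integral_add hi2 (hi4.const_mul 2), integral_const_mul, hlam] at h5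
  have h6 := hC (∫ x, ‖weakGradient v x‖ ^ 2) (integral_nonneg fun x => sq_nonneg _)
  linarith

end DualNLS

/-! ### Finiteness of the infimum and bounded minimizing sequences -/

theorem lemma2p3 (N m : ℕ) (hN : 4 ≤ N) (hm : 2 ≤ m) (hmN : 2 * m ≤ N) (hNm : N - 2 * m ≠ 1)
    (p : ℝ) (hp₁ : 2 < p) (hp₂ : p < 4 + 4 / (N : ℝ)) (lam : ℝ) (hlam : 0 < lam) :
    (∀ v ∈ DualNLS.constraintSet N m lam, Integrable (fun x => |DualNLS.dual (v x)| ^ p)) ∧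
    (⊥ < DualNLS.infEnergy N m p lam ∧ DualNLS.infEnergy N m p lam < ⊤) ∧
    (∀ v : ℕ → EuclideanSpace ℝ (Fin N) → ℝ,
      (∀ n, v n ∈ DualNLS.constraintSet N m lam) →
      Tendsto (fun n => (DualNLS.energy p (v n) : EReal)) atTop
        (𝓝 (DualNLS.infEnergy N m p lam)) →
      ∃ C : ℝ, ∀ n, DualNLS.h1Norm (v n) ≤ C) := by
  have hH : ∀ v ∈ DualNLS.constraintSet N m lam, DualNLS.MemH1 v := fun v hv => hv.1.1
  have hA : ∀ v ∈ DualNLS.constraintSet N m lam, ∫ x, DualNLS.dual (v x) ^ 2 = lam := by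
    intro v hv
    have h := hv.2
    simpa only [sq_abs] using h
  obtain ⟨M, θ, -, -, -, hint⟩ := DualNLS.exists_integral_abs_dual_rpow_le hN hp₁ hp₂ lam
  obtain ⟨C, hC⟩ := DualNLS.exists_gradient_le_energy hN hp₁ hp₂ lam
  obtain ⟨C', hC'⟩ := DualNLS.exists_integral_sq_le hN lam
  have hbot : ⊥ < DualNLS.infEnergy N m p lam := by
    refine lt_of_lt_of_le (EReal.bot_lt_coe (-C)) (le_iInf₂ fun v hv => ?_)
    rw [EReal.coe_le_coe_iff]
    have h := hC v (hH v hv) (hA v hv)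
    have h0 : 0 ≤ ∫ x, ‖DualNLS.weakGradient v x‖ ^ 2 := integral_nonneg fun x => sq_nonneg _
    linarith
  have htop : DualNLS.infEnergy N m p lam < ⊤ := by
    obtain ⟨v, hv⟩ := DualNLS.constraintSet_nonempty (by omega : 0 < m) hmN hlam
    exact (iInf₂_le v hv).trans_lt (EReal.coe_lt_top _)
  refine ⟨fun v hv => (hint v (hH v hv) (hA v hv)).1, ⟨hbot, htop⟩, fun v hv hlim => ?_⟩
  -- Finiteness of the infimum turns this into convergence in `ℝ`, so the energies are bounded
  -- above.
  rw [← EReal.coe_toReal htop.ne hbot.ne', EReal.tendsto_coe] at hlim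
  obtain ⟨B, hB⟩ := hlim.bddAbove_range
  -- With `D = ∫ |∇v|²`, the bounds `D ≤ 4(B + C)` and `∫ v² ≤ D/4 + C'` add up to `5D/4 + C'`.
  refine ⟨√(5 * (B + C) + C'), fun n => Real.sqrt_le_sqrt ?_⟩
  have h1 := hC (v n) (hH _ (hv n)) (hA _ (hv n))
  have h2 := hC' (v n) (hH _ (hv n)) (hA _ (hv n))
  have h3 : DualNLS.energy p (v n) ≤ B := hB ⟨n, rfl⟩
  linarith
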